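/- Let $\mathcal N$ be a two-qubit quantum channel, i.e. $\mathcal N(X)=\sum_i K_iXK_i^\dagger$ with finitely many Kraus operators on $\mathbb C^2\otimes\mathbb C^2$ satisfying $\sum_i K_i^\dagger K_i=I$. Assume that $\mathcal N$ is symmetric, i.e. it commutes with conjugation by the swap of the two qubits, and that it does not completely erase single qubits: there are two-qubit density matrices $\rho_0,\sigma_0$ with $\mathrm{Tr}_2\,\mathcal N(\rho_0)\neq\mathrm{Tr}_2\,\mathcal N(\sigma_0)$, where $\mathrm{Tr}_2$ is the partial trace over the second qubit. Then there is a constant $\Gamma>0$, depending only on $\mathcal N$, such that the following holds for all $n,D\ge 0$. Consider a noisy random circuit on $n$ qubits that consists of $D$ parallel layers. In each layer the qubits are partitioned, in a fixed but arbitrary way that may differ from layer to layer, into pairs, so that each qubit is in exactly one pair. On each pair a two-qubit unitary gate acts, followed by the channel $\mathcal N$ on the same pair. All gates are independent and distributed according to the Haar probability measure on the unitary group $U(4)$. Let $\mathcal C$ be the resulting random channel on $n$ qubits (the composition of the layers) and $\mathbb E$ the expectation over the gates. Then for any two bit strings $\vec z\neq\vec z'$ in $\{0,1\}^n$, the initial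 states $\rho=|\vec z\rangle\langle\vec z|$ and $\sigma=|\vec z'\rangle\langle\vec z'|$ satisfy $$\frac12\,\mathbb E\,\bigl\|\mathcal C(\rho-\sigma)\bigr\|_1\ \ge\ e^{-\Gamma D},$$ where $\|M\|_1=\mathrm{Tr}\sqrt{M^\dagger M}$ is the trace norm. -/

import Mathlib

open MeasureTheory TopologicalSpace
open scoped Matrix ComplexOrder

noncomputable section

namespace NoisyCircuit

/-- Operators on the two-qubit space `ℂ² ⊗ ℂ²`, as matrices in the computational basis. -/
abbrev TwoQubitOp : Type := Matrix (Fin 2 × Fin 2) (Fin 2 × Fin 2) ℂ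

/-- Operators on the space of `n` qubits; basis states are labelled by bit strings. -/
abbrev QubitsOp (n : ℕ) : Type := Matrix (Fin n → Fin 2) (Fin n → Fin 2) ℂ

/-- The compact group `U(4)` of two-qubit gates. -/
abbrev TwoQubitUnitary : Type := ↥(Matrix.unitaryGroup (Fin 2 × Fin 2) ℂ)

instance instMeasurableSpaceTwoQubitUnitary : MeasurableSpace TwoQubitUnitary :=
  borel TwoQubitUnitary

instance instBorelSpaceTwoQubitUnitary : BorelSpace TwoQubitUnitary := ⟨rfl⟩

instance instCompactSpaceTwoQubitUnitary : CompactSpace TwoQubitUnitary := by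
  apply isCompact_iff_compactSpace.mp
  have hbox : IsCompact (Set.univ.pi fun _ : Fin 2 × Fin 2 =>
      Set.univ.pi fun _ : Fin 2 × Fin 2 => Metric.closedBall (0 : ℂ) 1) :=
    isCompact_univ_pi fun _ => isCompact_univ_pi fun _ => isCompact_closedBall _ _
  refine hbox.of_isClosed_subset ?_ ?_
  · have h : (Matrix.unitaryGroup (Fin 2 × Fin 2) ℂ : Set TwoQubitOp)
        = {U | U * star U = 1} := by
      ext U
      exact Matrix.mem_unitaryGroup_iff
    change IsClosed (Matrix.unitaryGroup (Fin 2 × Fin 2) ℂ : Set TwoQubitOp)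
    rw [h]
    exact isClosed_eq (continuous_id.mul continuous_star) continuous_const
  · intro U hU i _ j _
    simpa using entry_norm_bound_of_unitary hU i j

/-- The Haar probability measure on the two-qubit gates. -/
def haarGate : Measure TwoQubitUnitary := Measure.haarMeasure ⊤

instance instIsProbabilityMeasureHaarGate : IsProbabilityMeasure haarGate :=
  ⟨by simpa [haarGate] using
    Measure.haarMeasure_self (K₀ := (⊤ : PositiveCompacts TwoQubitUnitary))⟩

/-- A two-qubit noise channel (completely positive trace-preserving map), given by finitely many
Kraus operators. -/
structure NoiseChannel where
  numKraus : ℕ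
  kraus : Fin numKraus → TwoQubitOp
  complete : ∑ i, (kraus i)ᴴ * kraus i = 1

/-- The action `X ↦ ∑ᵢ Kᵢ X Kᵢ†` of the channel. -/
def NoiseChannel.apply (N : NoiseChannel) (X : TwoQubitOp) : TwoQubitOp :=
  ∑ i, N.kraus i * X * (N.kraus i)ᴴ

/-- Conjugation by the operator that swaps the two qubits. -/
def swapQubits (X : TwoQubitOp) : TwoQubitOp := X.submatrix Prod.swap Prod.swap

/-- The channel is symmetric under swapping the two qubits. -/
def NoiseChannel.IsSymmetric (N : NoiseChannel) : Prop :=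
  ∀ X : TwoQubitOp, N.apply (swapQubits X) = swapQubits (N.apply X)

/-- The reduced operator on the first qubit: the partial trace over the second qubit. -/
def reducedFirst (X : TwoQubitOp) : Matrix (Fin 2) (Fin 2) ℂ :=
  Matrix.of fun a b => ∑ c, X (a, c) (b, c)

/-- Two-qubit density matrices. -/
def IsDensity (ρ : TwoQubitOp) : Prop := ρ.PosSemidef ∧ ρ.trace = 1

/-- The channel does not completely erase a single qubit: the reduced output state on one qubit
is not the same for all two-qubit input states. -/
def NoiseChannel.HasNonconstantMarginal (N : NoiseChannel) : Prop :=
  ∃ ρ σ : TwoQubitOp, IsDensity ρ ∧ IsDensity σ ∧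
    reducedFirst (N.apply ρ) ≠ reducedFirst (N.apply σ)

/-- A parallel layer on `n` qubits with `m` two-qubit gates: gate `g` acts on the qubits
`e (g, 0)` and `e (g, 1)`, and each of the `n` qubits is in exactly one gate. -/
abbrev Layer (n m : ℕ) : Type := Fin m × Fin 2 ≃ Fin n

/-- The tensor product `⨂_g A_g`, in which the two-qubit operator `A_g` acts on the qubits
`e (g, 0)` and `e (g, 1)` of the gate `g`. -/
def Layer.tensorOp {n m : ℕ} (e : Layer n m) (A : Fin m → TwoQubitOp) : QubitsOp n :=
  Matrix.of fun x y =>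
    ∏ g, A g (x (e (g, 0)), x (e (g, 1))) (y (e (g, 0)), y (e (g, 1)))

/-- The action of the unitary gates of one layer. -/
def Layer.applyGates {n m : ℕ} (e : Layer n m) (U : Fin m → TwoQubitUnitary)
    (X : QubitsOp n) : QubitsOp n :=
  e.tensorOp (fun g => (U g : TwoQubitOp)) * X * (e.tensorOp fun g => (U g : TwoQubitOp))ᴴ

/-- The action of the noise `⨂_g 𝒩` of one layer, the same channel on the two qubits of each gate.
The Kraus operators of the product are the products of the Kraus operators of the factors. -/
def Layer.applyNoise {n m : ℕ} (e : Layer n m) (N : NoiseChannel) (X : QubitsOp n) :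
    QubitsOp n :=
  ∑ f : Fin m → Fin N.numKraus,
    e.tensorOp (fun g => N.kraus (f g)) * X * (e.tensorOp fun g => N.kraus (f g))ᴴ

/-- The noisy circuit with the layers `e 0, …, e (D - 1)` in this temporal order; in each layer
the gates are followed by the noise. -/
def circuit (N : NoiseChannel) {n m : ℕ} : (D : ℕ) → (Fin D → Layer n m) →
    (Fin D → Fin m → TwoQubitUnitary) → QubitsOp n → QubitsOp n
  | 0, _, _, X => X
  | D + 1, e, U, X =>
    (e (Fin.last D)).applyNoise N
      ((e (Fin.last D)).applyGates (U (Fin.last D))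
        (circuit N D (fun l => e l.castSucc) (fun l => U l.castSucc) X))

/-- All gates of all layers are independent and Haar-distributed. -/
def gateLaw (D m : ℕ) : Measure (Fin D → Fin m → TwoQubitUnitary) :=
  Measure.pi fun _ => Measure.pi fun _ => haarGate

/-- The computational basis state `|z⟩⟨z|`. -/
def basisState {n : ℕ} (z : Fin n → Fin 2) : QubitsOp n := Matrix.single z z 1

/-- The trace norm `‖M‖₁ = Tr √(M† M)`: the sum of the square roots of the eigenvalues
of `M† M`. -/
def traceNorm {n : ℕ} (M : QubitsOp n) : ℝ :=
  ∑ i, Real.sqrt ((Matrix.isHermitian_conjTranspose_mul_self M).eigenvalues i)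

end NoisyCircuit

end

/-! It suffices to follow the difference of the two states on one qubit, chosen deterministically in
each layer. If the qubit lies in gate `g`, the reduction `Y` of the difference to that pair is at
least half as large as its reduction to the qubit. Gate and noise turn `Y` into `N(U Y U†)`, whose
first-qubit marginal is `M(U Y U†)` for a fixed linear map `M` that is nonzero on traceless
matrices.

Conjugation by unitaries acts irreducibly on traceless matrices, so `M` cannot kill the whole orbit
of a traceless `Y ≠ 0` (`map_eq_zero_of_map_orbit_eq_zero`). The Haar average of `‖M(U Y U†)‖` is
therefore positive, and by compactness at least `c‖Y‖` with `c` depending only on `N`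
(`exists_le_integral_norm_orbit`). Induction over the layers loses a constant factor per layer
(`exists_decay_rate`), and the trace norm dominates every one-qubit reduction
(`norm_siteReduce_le`). -/

namespace NoisyCircuit

/-! ### Tensor products over sites and partial traces onto one site -/

section TensorProducts

variable {κ ι : Type*} [Fintype κ] [Fintype ι] [DecidableEq κ] [DecidableEq ι]

/-- The tensor product of one operator per site. -/
def piOp (A : κ → Matrix ι ι ℂ) : Matrix (κ → ι) (κ → ι) ℂ :=
  Matrix.of fun x y => ∏ k, A k (x k) (y k)

omit [DecidableEq ι] in
theorem piOp_mul (A B : κ → Matrix ι ι ℂ) :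
    piOp A * piOp B = piOp fun k => A k * B k := by
  ext x w
  simp only [piOp, Matrix.mul_apply, Matrix.of_apply, ← Finset.prod_mul_distrib]
  rw [Finset.prod_univ_sum]
  simp

omit [Fintype ι] [DecidableEq κ] in
theorem piOp_one : piOp (fun _ : κ => (1 : Matrix ι ι ℂ)) = 1 := by
  ext x y
  simp only [piOp, Matrix.of_apply, Matrix.one_apply]
  by_cases h : x = y
  · simp [h]
  · obtain ⟨k, hk⟩ := Function.ne_iff.mp h
    rw [if_neg h]
    exact Finset.prod_eq_zero (Finset.mem_univ k) (if_neg hk)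

omit [Fintype ι] [DecidableEq κ] [DecidableEq ι] in
theorem piOp_conjTranspose (A : κ → Matrix ι ι ℂ) :
    (piOp A)ᴴ = piOp fun k => (A k)ᴴ := by
  ext x y
  simp [piOp, Matrix.conjTranspose_apply]

omit [Fintype ι] [DecidableEq ι] in
theorem sum_piOp {τ : Type*} [Fintype τ] (A : κ → τ → Matrix ι ι ℂ) :
    ∑ f : κ → τ, piOp (fun k => A k (f k)) = piOp fun k => ∑ i, A k i := by
  ext x y
  simp only [piOp, Matrix.of_apply, Matrix.sum_apply]
  rw [Finset.prod_univ_sum]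
  simp

omit [Fintype ι] in
theorem piOp_update_apply (k : κ) (b : Matrix ι ι ℂ) (x y : κ → ι) :
    piOp (Function.update 1 k b) x y =
      b (x k) (y k) * ∏ j ∈ Finset.univ.erase k, (1 : Matrix ι ι ℂ) (x j) (y j) := by
  rw [piOp, Matrix.of_apply, ← Finset.mul_prod_erase _ _ (Finset.mem_univ k)]
  congr 1
  · simp
  · refine Finset.prod_congr rfl fun j hj => ?_
    rw [Function.update_of_ne (Finset.ne_of_mem_erase hj)]
    rfl

/-- The operator `b` on the site `k`, as an operator on all sites. -/
def siteOp (k : κ) : Matrix ι ι ℂ →ₗ[ℂ] Matrix (κ → ι) (κ → ι) ℂ where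
  toFun b := piOp (Function.update 1 k b)
  map_add' a b := by
    ext x y
    simp [piOp_update_apply, add_mul]
  map_smul' c b := by
    ext x y
    simp [piOp_update_apply, mul_assoc]

omit [Fintype ι] in
theorem siteOp_one (k : κ) : siteOp k (1 : Matrix ι ι ℂ) = 1 := by
  change piOp (Function.update 1 k 1) = 1
  rw [show (Function.update 1 k 1 : κ → Matrix ι ι ℂ) = fun _ => 1 from
    Function.update_eq_self k _]
  exact piOp_one

theorem siteOp_mul (k : κ) (a b : Matrix ι ι ℂ) :
    siteOp k a * siteOp k b = siteOp k (a * b) := by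
  change piOp _ * piOp _ = piOp _
  rw [piOp_mul]
  congr 1
  ext j : 1
  by_cases h : j = k
  · subst h; simp
  · simp [Function.update_of_ne h]

omit [Fintype ι] in
theorem siteOp_conjTranspose (k : κ) (b : Matrix ι ι ℂ) :
    (siteOp k b)ᴴ = siteOp k bᴴ := by
  change (piOp _)ᴴ = piOp _
  rw [piOp_conjTranspose]
  congr 1
  ext j : 1
  by_cases h : j = k
  · subst h; simp
  · simp [Function.update_of_ne h]

/-- The reduction of an operator to the site `k`: the partial trace over all other sites. -/
def siteReduce (k : κ) : Matrix (κ → ι) (κ → ι) ℂ →ₗ[ℂ] Matrix ι ι ℂ where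
  toFun X := Matrix.of fun a b => (X * siteOp k (Matrix.single b a 1)).trace
  map_add' X Y := by ext; simp [add_mul]
  map_smul' c X := by ext; simp

theorem siteReduce_apply (k : κ) (X : Matrix (κ → ι) (κ → ι) ℂ) (a b : ι) :
    siteReduce k X a b = (X * siteOp k (Matrix.single b a 1)).trace := rfl

omit [Fintype κ] [DecidableEq κ] in
theorem trace_mul_single (Y : Matrix ι ι ℂ) (a b : ι) :
    (Y * Matrix.single b a 1).trace = Y a b := by
  simp [Matrix.trace_mul_single]

/-- Partial trace is dual to `siteOp` under the trace pairing. On matrix units this is the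
definition; linearity in `B` does the rest. -/
theorem trace_siteReduce_mul (k : κ) (X : Matrix (κ → ι) (κ → ι) ℂ) (B : Matrix ι ι ℂ) :
    (siteReduce k X * B).trace = (X * siteOp k B).trace := by
  have h : (Matrix.traceLinearMap ι ℂ ℂ ∘ₗ LinearMap.mulLeft ℂ (siteReduce k X)) =
      (Matrix.traceLinearMap (κ → ι) ℂ ℂ ∘ₗ LinearMap.mulLeft ℂ X ∘ₗ siteOp k) := by
    apply Matrix.ext_linearMap
    intro b a
    ext
    simp [trace_mul_single, siteReduce_apply]
  exact LinearMap.congr_fun h B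

theorem trace_siteReduce (k : κ) (X : Matrix (κ → ι) (κ → ι) ℂ) :
    (siteReduce k X).trace = X.trace := by
  simpa [siteOp_one] using trace_siteReduce_mul k X 1

omit [Fintype κ] [DecidableEq κ] in
theorem ext_trace_mul {Y Z : Matrix ι ι ℂ} (h : ∀ B, (Y * B).trace = (Z * B).trace) : Y = Z := by
  ext a b
  simpa [trace_mul_single] using h (Matrix.single b a 1)

end TensorProducts

/-! ### Reductions to pairs and single qubits under one layer -/

section Layers

variable {n m : ℕ}

/-- Bit strings of `n` qubits as families of pairs of bits, one pair for each gate of a layer. -/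
def Layer.splitBits (e : Layer n m) : (Fin n → Fin 2) ≃ (Fin m → Fin 2 × Fin 2) where
  toFun x g := (x (e (g, 0)), x (e (g, 1)))
  invFun w q := if (e.symm q).2 = 0 then (w (e.symm q).1).1 else (w (e.symm q).1).2
  left_inv x := by
    ext q
    obtain ⟨⟨g, i⟩, rfl⟩ := e.surjective q
    fin_cases i <;> simp
  right_inv w := by
    ext g <;> simp

theorem Layer.tensorOp_eq (e : Layer n m) (A : Fin m → TwoQubitOp) :
    e.tensorOp A = (piOp A).submatrix e.splitBits e.splitBits := rfl

/-- The operator on all qubits, arranged by the gates of a layer. -/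
def Layer.regroup (e : Layer n m) (X : QubitsOp n) :
    Matrix (Fin m → Fin 2 × Fin 2) (Fin m → Fin 2 × Fin 2) ℂ :=
  X.submatrix e.splitBits.symm e.splitBits.symm

theorem Layer.regroup_tensorOp (e : Layer n m) (A : Fin m → TwoQubitOp) :
    e.regroup (e.tensorOp A) = piOp A := by
  simp [Layer.regroup, Layer.tensorOp_eq]

theorem Layer.regroup_mul (e : Layer n m) (X Y : QubitsOp n) :
    e.regroup (X * Y) = e.regroup X * e.regroup Y :=
  (Matrix.submatrix_mul_equiv X Y _ e.splitBits.symm _).symm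

theorem Layer.regroup_conjTranspose (e : Layer n m) (X : QubitsOp n) :
    e.regroup Xᴴ = (e.regroup X)ᴴ := rfl

theorem Layer.regroup_sum (e : Layer n m) {τ : Type*} (s : Finset τ) (X : τ → QubitsOp n) :
    e.regroup (∑ i ∈ s, X i) = ∑ i ∈ s, e.regroup (X i) := by
  ext x y
  simp [Layer.regroup, Matrix.sum_apply]

theorem Layer.trace_regroup (e : Layer n m) (X : QubitsOp n) :
    (e.regroup X).trace = X.trace := by
  simp only [Layer.regroup, Matrix.trace, Matrix.diag_apply, Matrix.submatrix_apply]
  exact Equiv.sum_comp e.splitBits.symm fun x => X x x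

/-- The reduction of an operator to the two qubits of the gate `g`. -/
def Layer.pairReduce (e : Layer n m) (g : Fin m) (X : QubitsOp n) : TwoQubitOp :=
  siteReduce g (e.regroup X)

theorem Layer.trace_pairReduce (e : Layer n m) (g : Fin m) (X : QubitsOp n) :
    (e.pairReduce g X).trace = X.trace := by
  rw [Layer.pairReduce, trace_siteReduce, Layer.trace_regroup]

/-- Heisenberg picture: paired with `B` on site `k`, the dual of the product map sees the identity
on every other site, where completeness returns the identity. Taking one Kraus operator per site
covers the unitary gates as well as the noise. -/
theorem siteReduce_kraus {κ ι τ : Type*} [Fintype κ] [Fintype ι] [DecidableEq κ] [DecidableEq ι]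
    [Fintype τ] (K : κ → τ → Matrix ι ι ℂ) (hK : ∀ k, ∑ i, (K k i)ᴴ * K k i = 1)
    (X : Matrix (κ → ι) (κ → ι) ℂ) (k : κ) :
    siteReduce k (∑ f : κ → τ, piOp (fun j => K j (f j)) * X * (piOp fun j => K j (f j))ᴴ) =
      ∑ i, K k i * siteReduce k X * (K k i)ᴴ := by
  apply ext_trace_mul
  intro B
  have hadj : ∑ f : κ → τ, (piOp fun j => K j (f j))ᴴ * siteOp k B * piOp (fun j => K j (f j)) =
      siteOp k (∑ i, (K k i)ᴴ * B * K k i) := by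
    change ∑ f : κ → τ, (piOp fun j => K j (f j))ᴴ * piOp (Function.update 1 k B) *
      piOp (fun j => K j (f j)) = piOp (Function.update 1 k (∑ i, (K k i)ᴴ * B * K k i))
    simp only [piOp_conjTranspose, piOp_mul]
    rw [sum_piOp fun j i => (K j i)ᴴ * (Function.update 1 k B : κ → Matrix ι ι ℂ) j * K j i]
    congr 1
    ext j : 1
    by_cases h : j = k
    · subst h; simp
    · simp [Function.update_of_ne h, hK]
  rw [trace_siteReduce_mul, Finset.sum_mul, Finset.sum_mul, Matrix.trace_sum, Matrix.trace_sum]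
  have h1 : ∀ f : κ → τ, (piOp (fun j => K j (f j)) * X * (piOp fun j => K j (f j))ᴴ *
      siteOp k B).trace =
        (X * ((piOp fun j => K j (f j))ᴴ * siteOp k B * piOp (fun j => K j (f j)))).trace := by
    intro f
    rw [mul_assoc, mul_assoc, Matrix.trace_mul_comm, mul_assoc]
  have h2 : ∀ i, (K k i * siteReduce k X * (K k i)ᴴ * B).trace =
      (siteReduce k X * ((K k i)ᴴ * B * K k i)).trace := by
    intro i
    rw [mul_assoc, mul_assoc, Matrix.trace_mul_comm, mul_assoc]
  simp only [h1, h2]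
  rw [← Matrix.trace_sum, ← Matrix.trace_sum, ← Finset.mul_sum, ← Finset.mul_sum, hadj,
    trace_siteReduce_mul]

theorem Layer.pairReduce_applyNoise (e : Layer n m) (N : NoiseChannel) (X : QubitsOp n)
    (g : Fin m) : e.pairReduce g (e.applyNoise N X) = N.apply (e.pairReduce g X) := by
  simp only [Layer.pairReduce, Layer.applyNoise, Layer.regroup_sum, Layer.regroup_mul,
    Layer.regroup_conjTranspose, Layer.regroup_tensorOp]
  exact siteReduce_kraus (fun _ => N.kraus) (fun _ => N.complete) _ g

theorem Layer.pairReduce_applyGates (e : Layer n m) (U : Fin m → TwoQubitUnitary)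
    (X : QubitsOp n) (g : Fin m) :
    e.pairReduce g (e.applyGates U X) =
      (U g : TwoQubitOp) * e.pairReduce g X * (U g : TwoQubitOp)ᴴ := by
  simp only [Layer.pairReduce, Layer.applyGates, Layer.regroup_mul,
    Layer.regroup_conjTranspose, Layer.regroup_tensorOp]
  simpa using siteReduce_kraus (fun g (_ : Unit) => (U g : TwoQubitOp))
    (fun g => by
      simpa [Matrix.star_eq_conjTranspose, -SetLike.coe_mem]
        using Matrix.mem_unitaryGroup_iff'.mp (U g).2)
    (e.regroup X) g

/-- The tensor product of the two one-qubit operators `b 0` and `b 1`. -/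
def pairOp (b : Fin 2 → Matrix (Fin 2) (Fin 2) ℂ) : TwoQubitOp :=
  Matrix.of fun p q => b 0 p.1 q.1 * b 1 p.2 q.2

theorem Layer.tensorOp_pairOp (e : Layer n m) (B : Fin n → Matrix (Fin 2) (Fin 2) ℂ) :
    e.tensorOp (fun g => pairOp fun i => B (e (g, i))) = piOp B := by
  ext x y
  simp only [Layer.tensorOp, pairOp, piOp, Matrix.of_apply]
  rw [← Equiv.prod_comp e fun q => B q (x q) (y q), Fintype.prod_prod_type]
  simp

theorem pairOp_one : pairOp (fun _ => 1) = 1 := by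
  ext p q
  simp only [pairOp, Matrix.of_apply, Matrix.one_apply, Prod.ext_iff]
  split_ifs <;> simp_all

theorem Layer.regroup_siteOp (e : Layer n m) (g : Fin m) (i : Fin 2)
    (b : Matrix (Fin 2) (Fin 2) ℂ) :
    e.regroup (siteOp (e (g, i)) b) = siteOp g (pairOp (Function.update 1 i b)) := by
  change e.regroup (piOp (Function.update 1 (e (g, i)) b)) = piOp _
  rw [← e.tensorOp_pairOp, e.regroup_tensorOp]
  congr 1
  ext h : 1
  by_cases hg : h = g
  · subst hg
    rw [Function.update_self]
    congr 1
    ext j : 1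
    by_cases hj : j = i
    · subst hj; simp
    · simp [hj]
  · rw [Function.update_of_ne hg, Pi.one_apply, ← pairOp_one]
    congr 1
    ext j : 1
    rw [Function.update_of_ne (by simp [hg])]
    rfl

/-- The reduction of a two-qubit operator to its qubit `i`. -/
def qubitReduce (i : Fin 2) (Y : TwoQubitOp) : Matrix (Fin 2) (Fin 2) ℂ :=
  Matrix.of fun a b => (Y * pairOp (Function.update 1 i (Matrix.single b a 1))).trace

theorem Layer.siteReduce_eq (e : Layer n m) (g : Fin m) (i : Fin 2) (X : QubitsOp n) :
    siteReduce (e (g, i)) X = qubitReduce i (e.pairReduce g X) := by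
  ext a b
  rw [siteReduce_apply, qubitReduce, Matrix.of_apply, Layer.pairReduce, trace_siteReduce_mul,
    ← e.regroup_siteOp, ← e.regroup_mul, e.trace_regroup]

theorem qubitReduce_zero (Y : TwoQubitOp) : qubitReduce 0 Y = reducedFirst Y := by
  ext a b
  simp [qubitReduce, reducedFirst, pairOp, Matrix.trace, Matrix.mul_apply, Fintype.sum_prod_type,
    Matrix.single_apply, Matrix.one_apply]
  fin_cases a <;> fin_cases b <;> simp

theorem qubitReduce_one_apply (Y : TwoQubitOp) (a b : Fin 2) :
    qubitReduce 1 Y a b = ∑ c, Y (c, a) (c, b) := by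
  simp [qubitReduce, pairOp, Matrix.trace, Matrix.mul_apply, Fintype.sum_prod_type,
    Matrix.single_apply, Matrix.one_apply]
  fin_cases a <;> fin_cases b <;> simp

end Layers

/-! ### Trace norm: continuity and duality with unitaries -/

section TraceNorm

-- Continuity is not visible from the eigenvalues, but it is inherited from the operator absolute
-- value, whose trace this is.
open scoped Matrix.Norms.L2Operator MatrixOrder in
theorem continuous_traceNorm {n : ℕ} : Continuous (traceNorm (n := n)) := by
  have h : ∀ M : QubitsOp n, traceNorm M = (CFC.abs M).trace.re := by
    intro M
    have hH := Matrix.isHermitian_conjTranspose_mul_self M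
    rw [CFC.abs, CFC.sqrt_eq_real_sqrt _ (star_mul_self_nonneg M), cfcₙ_eq_cfc]
    change _ = (cfc Real.sqrt (Mᴴ * M)).trace.re
    rw [hH.cfc_eq, Matrix.IsHermitian.cfc, Unitary.conjStarAlgAut_apply, Matrix.trace_mul_comm,
      ← mul_assoc]
    simp [Matrix.trace, traceNorm]
  simp_rw [funext h]
  exact Complex.continuous_re.comp (Continuous.matrix_trace CFC.continuous_abs)

theorem traceNorm_nonneg {n : ℕ} (M : QubitsOp n) : 0 ≤ traceNorm M :=
  Finset.sum_nonneg fun _ _ => Real.sqrt_nonneg _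

theorem norm_toLp_mulVec_sq {ι : Type*} [Fintype ι] (M : Matrix ι ι ℂ) (v : ι → ℂ) :
    ((‖WithLp.toLp 2 (M *ᵥ v)‖ ^ 2 : ℝ) : ℂ) = star v ⬝ᵥ ((Mᴴ * M) *ᵥ v) := by
  rw [← Matrix.mulVec_mulVec, Matrix.dotProduct_mulVec, Matrix.vecMul_conjTranspose, star_star,
    dotProduct_comm]
  have := inner_self_eq_norm_sq_to_K (𝕜 := ℂ) (WithLp.toLp 2 (M *ᵥ v))
  rw [EuclideanSpace.inner_eq_star_dotProduct] at this
  simpa using this.symm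

/-- In an eigenbasis `b` of `M†M`, each diagonal term is at most `‖O M bᵢ‖ = ‖M bᵢ‖`, the square
root of the eigenvalue. -/
theorem norm_trace_mul_le_traceNorm {n : ℕ} (O M : QubitsOp n) (hO : Oᴴ * O = 1) :
    ‖(O * M).trace‖ ≤ traceNorm M := by
  have hH := Matrix.isHermitian_conjTranspose_mul_self M
  set b := hH.eigenvectorBasis with hb
  have htr : (O * M).trace = ∑ i, star (b i).ofLp ⬝ᵥ ((O * M) *ᵥ (b i).ofLp) := by
    have := LinearMap.trace_eq_sum_inner (𝕜 := ℂ) (Matrix.toEuclideanLin (O * M)) b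
    rw [show LinearMap.trace ℂ _ (Matrix.toEuclideanLin (O * M)) = (O * M).trace by
      simp [Matrix.toEuclideanLin_eq_toLin_orthonormal]] at this
    rw [this]
    refine Finset.sum_congr rfl fun i _ => ?_
    rw [EuclideanSpace.inner_eq_star_dotProduct, dotProduct_comm]
    rfl
  rw [htr, traceNorm]
  refine (norm_sum_le _ _).trans (Finset.sum_le_sum fun i _ => ?_)
  have h1 : ‖star (b i).ofLp ⬝ᵥ ((O * M) *ᵥ (b i).ofLp)‖ ≤
      ‖WithLp.toLp 2 ((O * M) *ᵥ (b i).ofLp)‖ := by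
    have := norm_inner_le_norm (𝕜 := ℂ) (b i) (WithLp.toLp 2 ((O * M) *ᵥ (b i).ofLp))
    rw [EuclideanSpace.inner_eq_star_dotProduct, dotProduct_comm, b.norm_eq_one, one_mul] at this
    exact this
  refine h1.trans (Real.le_sqrt_of_sq_le (le_of_eq ?_))
  rw [← Complex.ofReal_inj, norm_toLp_mulVec_sq, Matrix.conjTranspose_mul,
    show Mᴴ * Oᴴ * (O * M) = Mᴴ * M by rw [mul_assoc, ← mul_assoc Oᴴ, hO, one_mul],
    hH.mulVec_eigenvectorBasis]
  have h2 := inner_self_eq_norm_sq_to_K (𝕜 := ℂ) (b i)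
  rw [EuclideanSpace.inner_eq_star_dotProduct, dotProduct_comm, b.norm_eq_one] at h2
  rw [dotProduct_smul]
  simp only [← hb]
  rw [h2]
  simp

end TraceNorm

/-! ### Irreducibility of the adjoint action on traceless matrices -/

section AdjointAction

variable {ι : Type*} [Fintype ι] [DecidableEq ι]

/-- Since `E = E_ji` squares to zero, `[E, [E, Y]] = -2 E Y E = -2 Y_ij E`. -/
theorem single_mem_of_entry_ne_zero {W : Submodule ℂ (Matrix ι ι ℂ)}
    (hW : ∀ i j, ∀ Y ∈ W, Matrix.single i j 1 * Y - Y * Matrix.single i j 1 ∈ W)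
    {Y : Matrix ι ι ℂ} (hY : Y ∈ W) {i j : ι} (hij : i ≠ j) (h : Y i j ≠ 0) :
    Matrix.single j i 1 ∈ W := by
  have h1 := hW j i _ (hW j i Y hY)
  have h0 : (Matrix.single j i 1 * Matrix.single j i 1 : Matrix ι ι ℂ) = 0 := by
    simp [hij]
  have h2 : Matrix.single j i 1 * (Matrix.single j i 1 * Y - Y * Matrix.single j i 1) -
      (Matrix.single j i 1 * Y - Y * Matrix.single j i 1) * Matrix.single j i 1 =
      (-2 * Y i j) • (Matrix.single j i 1 : Matrix ι ι ℂ) := by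
    have h3 : Matrix.single j i 1 * Y * Matrix.single j i 1 =
        Y i j • (Matrix.single j i 1 : Matrix ι ι ℂ) := by
      simp [Matrix.single_mul_mul_single]
    calc _ = (Matrix.single j i 1 * Matrix.single j i 1) * Y
          + Y * (Matrix.single j i 1 * Matrix.single j i 1)
          - (2 : ℂ) • (Matrix.single j i 1 * Y * Matrix.single j i 1) := by
            rw [two_smul]; noncomm_ring
      _ = _ := by rw [h0, h3, smul_smul]; simp
  rw [h2] at h1
  exact (W.smul_mem_iff (by simpa using h)).mp h1

/-- A nonzero traceless `Y` is not scalar, so `Y` itself or a commutator `[E_ij, Y]` has a nonzero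
off-diagonal entry. This yields one off-diagonal matrix unit, and further commutators yield all of
them and the differences of diagonal ones. -/
theorem trace_zero_mem_of_commutator_mem {W : Submodule ℂ (Matrix ι ι ℂ)}
    (hW : ∀ i j, ∀ Y ∈ W, Matrix.single i j 1 * Y - Y * Matrix.single i j 1 ∈ W)
    {Y : Matrix ι ι ℂ} (hY : Y ∈ W) (hY0 : Y ≠ 0) (hYt : Y.trace = 0)
    {Z : Matrix ι ι ℂ} (hZ : Z.trace = 0) : Z ∈ W := by
  obtain ⟨i, j, hij, hE⟩ : ∃ i j : ι, i ≠ j ∧ Matrix.single i j 1 ∈ W := by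
    by_cases hd : ∃ i j, i ≠ j ∧ Y i j ≠ 0
    · obtain ⟨i, j, hij, h⟩ := hd
      exact ⟨j, i, hij.symm, single_mem_of_entry_ne_zero hW hY hij h⟩
    · push Not at hd
      obtain ⟨i, j, h⟩ : ∃ i j, Y i i ≠ Y j j := by
        by_contra! hc
        apply hY0
        have hzero : ∀ i, Y i i = 0 := by
          intro i
          have : (Fintype.card ι : ℂ) * Y i i = 0 := by
            rw [← hYt, Matrix.trace,
              Finset.sum_congr rfl fun j _ => (Matrix.diag_apply Y j).trans (hc j i)]
            simp
          have hc : (Fintype.card ι : ℂ) ≠ 0 := by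
            have : Nonempty ι := ⟨i⟩
            exact_mod_cast Fintype.card_ne_zero
          exact (mul_eq_zero.mp this).resolve_left hc
        ext i j
        by_cases hij : i = j
        · subst hij; exact hzero i
        · exact hd i j hij
      have hij : i ≠ j := fun hij => h (by rw [hij])
      refine ⟨j, i, hij.symm, single_mem_of_entry_ne_zero hW (hW i j Y hY) hij ?_⟩
      have : (Matrix.single i j 1 * Y - Y * Matrix.single i j 1 : Matrix ι ι ℂ) i j =
          Y j j - Y i i := by
        simp
      rw [this]
      exact sub_ne_zero.mpr h.symm
  have hswap : ∀ {k l : ι}, k ≠ l → Matrix.single k l 1 ∈ W → Matrix.single l k 1 ∈ W :=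
    fun hkl h => single_mem_of_entry_ne_zero hW h hkl (by simp)
  have hleft : ∀ {k l : ι}, k ≠ l → Matrix.single k l 1 ∈ W → ∀ a, a ≠ l →
      Matrix.single a l 1 ∈ W := by
    intro k l hkl h a hal
    have := hW a k _ h
    simpa [hal.symm] using this
  have hright : ∀ {k l : ι}, k ≠ l → Matrix.single k l 1 ∈ W → ∀ a, a ≠ k →
      Matrix.single k a 1 ∈ W :=
    fun hkl h a hak => hswap hak (hleft hkl.symm (hswap hkl h) a hak)
  have hoff : ∀ k l : ι, k ≠ l → Matrix.single k l 1 ∈ W := by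
    intro k l hkl
    by_cases hkj : k = j
    · subst hkj
      exact hright hij.symm (hswap hij hE) l hkl.symm
    · exact hright hkj (hleft hij hE k hkj) l hkl.symm
  have hdiag : ∀ k l : ι, Matrix.single k k 1 - Matrix.single l l 1 ∈ W := by
    intro k l
    by_cases hkl : k = l
    · simp [hkl]
    · simpa using hW k l _ (hoff l k (Ne.symm hkl))
  -- The subtracted diagonal terms add up to `tr Z • E_ii = 0`.
  have hZs : Z = ∑ k, ∑ l, Z k l • (Matrix.single k l 1 - if k = l then Matrix.single i i 1 else 0)
      := by
    have h1 : ∑ k, ∑ l, Z k l • (if k = l then Matrix.single i i 1 else 0 : Matrix ι ι ℂ) = 0 := by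
      simp only [smul_ite, smul_zero, Finset.sum_ite_eq, Finset.mem_univ, if_true]
      rw [← Finset.sum_smul, show ∑ k, Z k k = 0 from hZ, zero_smul]
    simp only [smul_sub, Finset.sum_sub_distrib, h1, sub_zero]
    conv_lhs => rw [Matrix.matrix_eq_sum_single Z]
    simp
  rw [hZs]
  refine Submodule.sum_mem _ fun k _ => Submodule.sum_mem _ fun l _ => Submodule.smul_mem _ _ ?_
  by_cases hkl : k = l
  · subst hkl
    simpa using hdiag k i
  · simpa [hkl] using hoff k l hkl

/-- For `|w| = 1` the matrix `1 + (w - 1)P` is unitary. Between the conjugates for `w = i` and `w =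
-i`, the terms `Y` and `|w - 1|² P Y P` cancel, leaving `2i[P, Y]`; no derivative is needed. -/
theorem commutator_mem_of_projection {W : Submodule ℂ (Matrix ι ι ℂ)}
    (hW : ∀ U ∈ Matrix.unitaryGroup ι ℂ, ∀ Y ∈ W, U * Y * Uᴴ ∈ W)
    {P : Matrix ι ι ℂ} (hP : Pᴴ = P) (hPP : P * P = P) {Y : Matrix ι ι ℂ} (hY : Y ∈ W) :
    P * Y - Y * P ∈ W := by
  have key : ∀ w : ℂ, w * star w = 1 →
      (1 + (w - 1) • P) * Y * (1 + (star w - 1) • P) ∈ W := by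
    intro w hw
    have hadj : (1 + (w - 1) • P)ᴴ = 1 + (star w - 1) • P := by
      simp [Matrix.conjTranspose_smul, hP]
    rw [← hadj]
    refine hW _ ?_ Y hY
    rw [Matrix.mem_unitaryGroup_iff, Matrix.star_eq_conjTranspose, hadj]
    have : (1 + (w - 1) • P) * (1 + (star w - 1) • P) =
        1 + ((w - 1) + (star w - 1) + (w - 1) * (star w - 1)) • P := by
      simp only [mul_add, add_mul, one_mul, mul_one, smul_mul_smul_comm, hPP, add_smul]
      abel
    rw [this, show (w - 1) + (star w - 1) + (w - 1) * (star w - 1) = 0 by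
      linear_combination hw]
    simp
  have h1 := key Complex.I (by simp)
  have h2 := key (-Complex.I) (by simp)
  have h3 := W.sub_mem h1 h2
  have h4 : (1 + (Complex.I - 1) • P) * Y * (1 + (star Complex.I - 1) • P) -
      (1 + (-Complex.I - 1) • P) * Y * (1 + (star (-Complex.I) - 1) • P) =
      (2 * Complex.I) • (P * Y - Y * P) := by
    simp only [star_neg, Complex.star_def, Complex.conj_I, neg_neg, mul_add, add_mul, one_mul,
      mul_one, Matrix.smul_mul, Matrix.mul_smul, smul_sub, smul_smul]
    module
  rw [h4] at h3
  exact (W.smul_mem_iff (by simp)).mp h3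

/-- For `i ≠ j`, `(E_ii + E_jj + w E_ij + w̄ E_ji)/2` is a projection when `|w| = 1`. A discrete
Fourier sum over `w = ±1, ±i` isolates the coefficient of `w`. -/
theorem commutator_mem_of_conj_mem {W : Submodule ℂ (Matrix ι ι ℂ)}
    (hW : ∀ U ∈ Matrix.unitaryGroup ι ℂ, ∀ Y ∈ W, U * Y * Uᴴ ∈ W)
    (i j : ι) {Y : Matrix ι ι ℂ} (hY : Y ∈ W) :
    Matrix.single i j 1 * Y - Y * Matrix.single i j 1 ∈ W := by
  by_cases hij : i = j
  · subst hij
    exact commutator_mem_of_projection hW (by simp) (by simp) hY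
  have key : ∀ w : ℂ, w * star w = 1 →
      w • (Matrix.single i j 1 * Y - Y * Matrix.single i j 1) +
        star w • (Matrix.single j i 1 * Y - Y * Matrix.single j i 1) +
        ((Matrix.single i i 1 + Matrix.single j j 1) * Y -
          Y * (Matrix.single i i 1 + Matrix.single j j 1)) ∈ W := by
    intro w hw
    have h1 := commutator_mem_of_projection hW
      (P := (1 / 2 : ℂ) • (Matrix.single i i 1 + Matrix.single j j 1 + w • Matrix.single i j 1 +
        star w • Matrix.single j i 1)) ?_ ?_ hY
    · have := W.smul_mem 2 h1
      convert this using 1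
      simp only [mul_add, add_mul, Matrix.smul_mul, Matrix.mul_smul, smul_sub, smul_add, smul_smul]
      module
    · simp
      module
    · simp only [mul_add, add_mul, Matrix.smul_mul, Matrix.mul_smul, smul_add, smul_smul,
        Matrix.single_mul_single_same, mul_one,
        Matrix.single_mul_single_of_ne _ _ _ _ hij,
        Matrix.single_mul_single_of_ne _ _ _ _ (Ne.symm hij),
        smul_zero]
      match_scalars <;> first | ring1 | linear_combination (1 / 4 : ℂ) * hw
  have h1 := key 1 (by simp)
  have h2 := key (-1) (by simp)
  have h3 := key Complex.I (by simp)
  have h4 := key (-Complex.I) (by simp)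
  have h5 := W.add_mem (W.sub_mem h1 h2) (W.smul_mem (-Complex.I) (W.sub_mem h3 h4))
  refine (W.smul_mem_iff (s := (4 : ℂ)) (by norm_num)).mp ?_
  convert h5 using 1
  simp only [star_neg, Complex.star_def, Complex.conj_I, star_one]
  generalize Matrix.single i j 1 * Y - Y * Matrix.single i j 1 = A
  match_scalars <;> ring_nf <;> norm_num [Complex.I_sq]

theorem trace_zero_mem_of_conj_mem {W : Submodule ℂ (Matrix ι ι ℂ)}
    (hW : ∀ U ∈ Matrix.unitaryGroup ι ℂ, ∀ Y ∈ W, U * Y * Uᴴ ∈ W)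
    {Y : Matrix ι ι ℂ} (hY : Y ∈ W) (hY0 : Y ≠ 0) (hYt : Y.trace = 0)
    {Z : Matrix ι ι ℂ} (hZ : Z.trace = 0) : Z ∈ W :=
  trace_zero_mem_of_commutator_mem (fun i j _ h => commutator_mem_of_conj_mem hW i j h)
    hY hY0 hYt hZ

/-- A linear map that vanishes on the unitary orbit of a nonzero traceless matrix vanishes on all
traceless matrices. -/
theorem map_eq_zero_of_map_orbit_eq_zero {V : Type*} [AddCommGroup V] [Module ℂ V]
    (M : Matrix ι ι ℂ →ₗ[ℂ] V) {Y : Matrix ι ι ℂ} (hY0 : Y ≠ 0) (hYt : Y.trace = 0)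
    (h : ∀ U ∈ Matrix.unitaryGroup ι ℂ, M (U * Y * Uᴴ) = 0)
    {Z : Matrix ι ι ℂ} (hZ : Z.trace = 0) : M Z = 0 := by
  -- The matrices whose entire orbit is killed form an invariant subspace.
  let W : Submodule ℂ (Matrix ι ι ℂ) :=
    { carrier := {X | ∀ U ∈ Matrix.unitaryGroup ι ℂ, M (U * X * Uᴴ) = 0}
      add_mem' := fun {a b} ha hb U hU => by
        rw [mul_add, add_mul, map_add, ha U hU, hb U hU, add_zero]
      zero_mem' := fun U _ => by simp
      smul_mem' := fun c X hX U hU => by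
        rw [Matrix.mul_smul, Matrix.smul_mul, map_smul, hX U hU, smul_zero] }
  have hW : ∀ U ∈ Matrix.unitaryGroup ι ℂ, ∀ X ∈ W, U * X * Uᴴ ∈ W := by
    intro U hU X hX V hV
    have := hX (V * U) (mul_mem hV hU)
    simpa [Matrix.conjTranspose_mul, mul_assoc] using this
  have hZW : Z ∈ W := trace_zero_mem_of_conj_mem hW (Y := Y) h hY0 hYt hZ
  simpa using hZW 1 (one_mem _)

end AdjointAction

/-! ### Haar averages of orbits, in the entrywise sup norm -/

section NormedMatrices

attribute [local instance] Matrix.normedAddCommGroup Matrix.normedSpace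

theorem continuous_conj_gate {α : Type*} [TopologicalSpace α] {Y : α → TwoQubitOp}
    {U : α → TwoQubitUnitary} (hY : Continuous Y) (hU : Continuous U) :
    Continuous fun a => (U a : TwoQubitOp) * Y a * (U a : TwoQubitOp)ᴴ := by
  have h : Continuous fun a => (U a : TwoQubitOp) := continuous_subtype_val.comp hU
  exact (h.mul hY).mul h.matrix_conjTranspose

instance instIsHaarMeasureHaarGate : haarGate.IsHaarMeasure := by unfold haarGate; infer_instance

/-- The Haar average of the norm of a nonconstant linear image of the unitary orbit. -/
theorem exists_le_integral_norm_orbit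
    (M : TwoQubitOp →ₗ[ℂ] Matrix (Fin 2) (Fin 2) ℂ)
    (hM : ∃ Z : TwoQubitOp, Z.trace = 0 ∧ M Z ≠ 0) :
    ∃ c : ℝ, 0 < c ∧ ∀ Y : TwoQubitOp, Y.trace = 0 →
      c * ‖Y‖ ≤ ∫ U : TwoQubitUnitary,
        ‖M ((U : TwoQubitOp) * Y * (U : TwoQubitOp)ᴴ)‖ ∂haarGate := by
  have hMc : Continuous M := M.continuous_of_finiteDimensional
  set F : TwoQubitOp → ℝ := fun Y => ∫ U : TwoQubitUnitary,
    ‖M ((U : TwoQubitOp) * Y * (U : TwoQubitOp)ᴴ)‖ ∂haarGate with hF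
  have hFc : Continuous F := by
    have : FirstCountableTopology TwoQubitOp :=
      inferInstanceAs (FirstCountableTopology (Fin 2 × Fin 2 → Fin 2 × Fin 2 → ℂ))
    have : LocallyCompactSpace TwoQubitOp :=
      inferInstanceAs (LocallyCompactSpace (Fin 2 × Fin 2 → Fin 2 × Fin 2 → ℂ))
    have := continuous_parametric_integral_of_continuous (μ := haarGate)
      (f := fun (Y : TwoQubitOp) (U : TwoQubitUnitary) =>
        ‖M ((U : TwoQubitOp) * Y * (U : TwoQubitOp)ᴴ)‖)
      (hMc.comp (continuous_conj_gate continuous_fst continuous_snd)).norm isCompact_univ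
    simpa only [Measure.restrict_univ] using this
  have hFpos : ∀ Y : TwoQubitOp, Y ≠ 0 → Y.trace = 0 → 0 < F Y := by
    intro Y hY0 hYt
    obtain ⟨Z, hZt, hZ⟩ := hM
    obtain ⟨U, hU, hne⟩ : ∃ U ∈ Matrix.unitaryGroup (Fin 2 × Fin 2) ℂ, M (U * Y * Uᴴ) ≠ 0 := by
      by_contra! h
      exact hZ (map_eq_zero_of_map_orbit_eq_zero M hY0 hYt h hZt)
    -- Haar measure charges open sets, so one unitary with nonzero image is enough.
    exact Continuous.integral_pos_of_hasCompactSupport_nonneg_nonzero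
      (x := (⟨U, hU⟩ : TwoQubitUnitary))
      (hMc.comp (continuous_conj_gate continuous_const continuous_id)).norm
      (HasCompactSupport.of_compactSpace _) (fun _ => norm_nonneg _) (norm_ne_zero_iff.mpr hne)
  have hFsmul : ∀ (r : ℝ) (Y : TwoQubitOp), F ((r : ℂ) • Y) = |r| * F Y := by
    intro r Y
    simp only [hF, Matrix.mul_smul, Matrix.smul_mul, map_smul, norm_smul, Complex.norm_real,
      Real.norm_eq_abs]
    rw [integral_const_mul]
  -- `F` is homogeneous of degree one, so its minimum on the traceless unit sphere is the constant.
  have hS : IsCompact {Y : TwoQubitOp | Y ∈ Metric.sphere (0 : TwoQubitOp) 1 ∧ Y.trace = 0} :=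
    (isCompact_sphere _ _).inter_right
      (isClosed_eq (Continuous.matrix_trace continuous_id) continuous_const)
  have hnormalize : ∀ Y : TwoQubitOp, Y ≠ 0 → Y.trace = 0 → ((‖Y‖⁻¹ : ℝ) : ℂ) • Y ∈
      {Y : TwoQubitOp | Y ∈ Metric.sphere (0 : TwoQubitOp) 1 ∧ Y.trace = 0} := by
    intro Y hY0 hYt
    have : ‖Y‖ ≠ 0 := norm_ne_zero_iff.mpr hY0
    refine ⟨?_, by simp [hYt]⟩
    rw [mem_sphere_zero_iff_norm, norm_smul, Complex.norm_real, norm_inv, norm_norm,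
      inv_mul_cancel₀ this]
  have hne : {Y : TwoQubitOp | Y ∈ Metric.sphere (0 : TwoQubitOp) 1 ∧ Y.trace = 0}.Nonempty := by
    obtain ⟨Z, hZt, hZ⟩ := hM
    exact ⟨_, hnormalize Z (fun h => hZ (by simp [h])) hZt⟩
  obtain ⟨Y₀, hY₀, hmin⟩ := hS.exists_isMinOn hne hFc.continuousOn
  have hY₀0 : Y₀ ≠ 0 := by
    rintro rfl
    simpa using hY₀.1
  refine ⟨F Y₀, hFpos Y₀ hY₀0 hY₀.2, fun Y hYt => ?_⟩
  change F Y₀ * ‖Y‖ ≤ F Y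
  by_cases hY0 : Y = 0
  · subst hY0
    rw [norm_zero, mul_zero]
    exact integral_nonneg fun _ => norm_nonneg _
  · have h1 : F Y₀ ≤ F (((‖Y‖⁻¹ : ℝ) : ℂ) • Y) := hmin (hnormalize Y hY0 hYt)
    have hpos : 0 < ‖Y‖ := norm_pos_iff.mpr hY0
    rw [hFsmul, abs_of_pos (inv_pos.mpr hpos), ← div_eq_inv_mul] at h1
    exact (le_div_iff₀ hpos).mp h1


/-! ### One step of the reduced dynamics, and trace preservation -/

variable {n m : ℕ}

/-- The reduced output on the first qubit of a gate, as a linear map of the input of the noise. -/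
def NoiseChannel.marginal (N : NoiseChannel) : TwoQubitOp →ₗ[ℂ] Matrix (Fin 2) (Fin 2) ℂ where
  toFun Y := reducedFirst (N.apply Y)
  map_add' Y Z := by
    ext a b
    simp [NoiseChannel.apply, reducedFirst, mul_add, add_mul, Finset.sum_add_distrib]
  map_smul' c Y := by
    ext a b
    simp [NoiseChannel.apply, reducedFirst, ← Finset.smul_sum, mul_add]

theorem NoiseChannel.HasNonconstantMarginal.exists_marginal_ne_zero {N : NoiseChannel}
    (hN : N.HasNonconstantMarginal) : ∃ Z : TwoQubitOp, Z.trace = 0 ∧ N.marginal Z ≠ 0 := by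
  obtain ⟨ρ, σ, hρ, hσ, hne⟩ := hN
  refine ⟨ρ - σ, by simp [hρ.2, hσ.2], ?_⟩
  rw [map_sub]
  exact sub_ne_zero.mpr hne

/-- Only gate `g` of the layer enters, so a single Haar average suffices. -/
theorem Layer.siteReduce_step (e : Layer n m) (N : NoiseChannel) (U : Fin m → TwoQubitUnitary)
    (X : QubitsOp n) (g : Fin m) :
    siteReduce (e (g, 0)) (e.applyNoise N (e.applyGates U X)) =
      N.marginal ((U g : TwoQubitOp) * e.pairReduce g X * (U g : TwoQubitOp)ᴴ) := by
  rw [e.siteReduce_eq, qubitReduce_zero, e.pairReduce_applyNoise, e.pairReduce_applyGates]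
  rfl

theorem norm_qubitReduce_le (i : Fin 2) (Y : TwoQubitOp) : ‖qubitReduce i Y‖ ≤ 2 * ‖Y‖ := by
  rw [Matrix.norm_le_iff (by positivity)]
  intro a b
  have h : ∀ p q r s : Fin 2, ‖Y (p, q) (r, s)‖ ≤ ‖Y‖ := fun _ _ _ _ =>
    Matrix.norm_entry_le_entrywise_sup_norm Y
  fin_cases i
  · change ‖qubitReduce 0 Y a b‖ ≤ _
    rw [qubitReduce_zero, reducedFirst, Matrix.of_apply, Fin.sum_univ_two]
    linarith [norm_add_le (Y (a, 0) (b, 0)) (Y (a, 1) (b, 1)), h a 0 b 0, h a 1 b 1]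
  · change ‖qubitReduce 1 Y a b‖ ≤ _
    rw [qubitReduce_one_apply, Fin.sum_univ_two]
    linarith [norm_add_le (Y (0, a) (0, b)) (Y (1, a) (1, b)), h 0 a 0 b, h 1 a 1 b]

/-- The trace can be read off on any pair, which reduces the claim to two qubits; this is why a gate
`g` is supplied. -/
theorem Layer.trace_applyNoise (e : Layer n m) (N : NoiseChannel) (X : QubitsOp n) (g : Fin m) :
    (e.applyNoise N X).trace = X.trace := by
  rw [← e.trace_pairReduce g, e.pairReduce_applyNoise, NoiseChannel.apply, Matrix.trace_sum,
    ← e.trace_pairReduce g X]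
  have h : ∀ K Y : TwoQubitOp, (K * Y * Kᴴ).trace = (Kᴴ * K * Y).trace := fun K Y => by
    rw [Matrix.trace_mul_comm, ← mul_assoc]
  simp only [h]
  rw [← Matrix.trace_sum, ← Finset.sum_mul, N.complete, one_mul]

theorem Layer.trace_applyGates (e : Layer n m) (U : Fin m → TwoQubitUnitary) (X : QubitsOp n)
    (g : Fin m) : (e.applyGates U X).trace = X.trace := by
  rw [← e.trace_pairReduce g, e.pairReduce_applyGates, ← e.trace_pairReduce g X,
    Matrix.trace_mul_comm, ← mul_assoc,
    show (U g : TwoQubitOp)ᴴ * (U g : TwoQubitOp) = 1 from Matrix.mem_unitaryGroup_iff'.mp (U g).2,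
    one_mul]

theorem trace_circuit (N : NoiseChannel) (g : Fin m) (X : QubitsOp n) :
    ∀ (D : ℕ) (e : Fin D → Layer n m) (U : Fin D → Fin m → TwoQubitUnitary),
      (circuit N D e U X).trace = X.trace
  | 0, _, _ => rfl
  | D + 1, e, U => by
    rw [circuit, Layer.trace_applyNoise _ _ _ g, Layer.trace_applyGates _ _ _ g,
      trace_circuit N g X D]

/-! ### Continuity in the gates and integration over the last layer -/

theorem Layer.continuous_tensorOp (e : Layer n m) : Continuous e.tensorOp := by
  refine continuous_matrix fun x y => ?_
  refine continuous_finsetProd (Finset.univ : Finset (Fin m)) fun g _ => ?_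
  exact Continuous.matrix_elem (A := fun A : Fin m → TwoQubitOp => A g) (continuous_apply g) _ _

theorem Layer.continuous_applyGates (e : Layer n m) {α : Type*} [TopologicalSpace α]
    {U : α → Fin m → TwoQubitUnitary} {X : α → QubitsOp n} (hU : Continuous U)
    (hX : Continuous X) : Continuous fun a => e.applyGates (U a) (X a) := by
  have h : Continuous fun a => e.tensorOp fun g => (U a g : TwoQubitOp) :=
    e.continuous_tensorOp.comp
      (continuous_pi fun g => continuous_subtype_val.comp ((continuous_apply g).comp hU))
  exact (h.mul hX).mul h.matrix_conjTranspose

theorem Layer.continuous_applyNoise (e : Layer n m) (N : NoiseChannel) :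
    Continuous (e.applyNoise N) :=
  continuous_finsetSum _ fun _ _ => (continuous_const.mul continuous_id).mul continuous_const

theorem continuous_circuit (N : NoiseChannel) (X : QubitsOp n) :
    ∀ (D : ℕ) (e : Fin D → Layer n m), Continuous fun U => circuit N D e U X
  | 0, _ => continuous_const
  | D + 1, e => by
    have h := (continuous_circuit N X D fun l => e l.castSucc).comp
      (f := fun (U : Fin (D + 1) → Fin m → TwoQubitUnitary) (l : Fin D) => U l.castSucc)
      (continuous_pi fun l => continuous_apply l.castSucc)
    exact ((e (Fin.last D)).continuous_applyNoise N).comp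
      ((e (Fin.last D)).continuous_applyGates (continuous_apply (Fin.last D)) h)

instance instSecondCountableTopologyTwoQubitUnitary : SecondCountableTopology TwoQubitUnitary :=
  have : SecondCountableTopology TwoQubitOp :=
    inferInstanceAs (SecondCountableTopology (Fin 2 × Fin 2 → Fin 2 × Fin 2 → ℂ))
  inferInstanceAs (SecondCountableTopology
    ((Matrix.unitaryGroup (Fin 2 × Fin 2) ℂ : Set TwoQubitOp) : Type))

instance instIsProbabilityMeasureGateLaw (D m : ℕ) :
    IsProbabilityMeasure (gateLaw D m) := by
  unfold gateLaw; infer_instance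

theorem integrable_gateLaw {D m : ℕ} {f : (Fin D → Fin m → TwoQubitUnitary) → ℝ}
    (hf : Continuous f) : Integrable f (gateLaw D m) :=
  hf.integrable_of_hasCompactSupport (HasCompactSupport.of_compactSpace _)

/-- Fubini splits off the last layer; its gates other than `g` integrate to one. -/
theorem integral_gateLaw_succ {D m : ℕ} {f : (Fin (D + 1) → Fin m → TwoQubitUnitary) → ℝ}
    (hf : Continuous f) (g : Fin m) {F : (Fin D → Fin m → TwoQubitUnitary) → TwoQubitUnitary → ℝ}
    (hF : ∀ U, Continuous (F U))
    (hfF : ∀ U, f U = F (fun l => U l.castSucc) (U (Fin.last D) g)) :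
    Integrable (fun U => ∫ V, F U V ∂haarGate) (gateLaw D m) ∧
    ∫ U, f U ∂gateLaw (D + 1) m = ∫ U, ∫ V, F U V ∂haarGate ∂gateLaw D m := by
  have hmp := (measurePreserving_piFinSuccAbove
    (fun _ : Fin (D + 1) => Measure.pi fun _ : Fin m => haarGate) (Fin.last D)).symm
  have hint := (hmp.integrable_comp_emb (MeasurableEquiv.measurableEmbedding _)).mpr
    (integrable_gateLaw hf)
  have hcomp : ∀ p : (Fin m → TwoQubitUnitary) × (Fin D → Fin m → TwoQubitUnitary),
      f ((MeasurableEquiv.piFinSuccAbove (fun _ => Fin m → TwoQubitUnitary) (Fin.last D)).symm p) =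
        F p.2 (p.1 g) := by
    intro p
    rw [hfF]
    simp [MeasurableEquiv.piFinSuccAbove_symm_apply, Fin.insertNthEquiv]
  have heval : ∀ U, ∫ V : Fin m → TwoQubitUnitary, F U (V g) ∂Measure.pi (fun _ => haarGate) =
      ∫ V, F U V ∂haarGate := by
    intro U
    have h := measurePreserving_eval (fun _ : Fin m => haarGate) g
    conv_rhs => rw [← h.map_eq]
    exact (integral_map h.measurable.aemeasurable
      (hF U).aestronglyMeasurable).symm
  have hint' : Integrable (fun p : (Fin m → TwoQubitUnitary) ×
      (Fin D → Fin m → TwoQubitUnitary) => F p.2 (p.1 g))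
      ((Measure.pi fun _ => haarGate).prod (gateLaw D m)) := by
    refine hint.congr (Filter.Eventually.of_forall fun p => ?_)
    exact hcomp p
  constructor
  · simpa only [heval] using hint'.integral_prod_right
  · rw [gateLaw, ← hmp.integral_comp']
    simp only [hcomp]
    rw [← gateLaw, integral_prod_symm _ hint']
    simp only [heval]

/-! ### Decay over the layers and comparison with the trace norm -/

/-- Each layer decreases the expected norm of the reduced operator of one suitable qubit by at most
a constant factor. -/
theorem exists_decay_rate (N : NoiseChannel) (hN : N.HasNonconstantMarginal) :
    ∃ c : ℝ, 0 < c ∧ c ≤ 1 ∧ ∀ (n m D : ℕ) (e : Fin D → Layer n m) (X : QubitsOp n),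
      X.trace = 0 → ∀ q : Fin n, ∃ q' : Fin n,
        c ^ D * ‖siteReduce q X‖ ≤
          ∫ U, ‖siteReduce q' (circuit N D e U X)‖ ∂gateLaw D m := by
  obtain ⟨c, hc, hcY⟩ := exists_le_integral_norm_orbit N.marginal hN.exists_marginal_ne_zero
  -- The `2` is the loss from pair to qubit in `norm_qubitReduce_le`; the cap at `1` later makes `Γ`
  -- positive.
  refine ⟨min 1 (c / 2), by positivity, min_le_left _ _, fun n m D => ?_⟩
  induction D with
  | zero =>
    intro e X _ q
    refine ⟨q, ?_⟩
    simp [circuit]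
  | succ D ih =>
    intro e X hX q
    obtain ⟨q₁, hq₁⟩ := ih (fun l => e l.castSucc) X hX q
    obtain ⟨⟨g, i⟩, rfl⟩ := (e (Fin.last D)).surjective q₁
    -- Whichever qubit of the gate was tracked, its first qubit is tracked next; the choice does not
    -- depend on the gates drawn.
    refine ⟨e (Fin.last D) (g, 0), ?_⟩
    have hred : ∀ k : Fin n, Continuous (siteReduce k : QubitsOp n →ₗ[ℂ] _) :=
      fun k => (siteReduce k).continuous_of_finiteDimensional
    obtain ⟨hint, heq⟩ := integral_gateLaw_succ
      (f := fun U => ‖siteReduce (e (Fin.last D) (g, 0)) (circuit N (D + 1) e U X)‖)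
      ((hred _).comp (continuous_circuit N X (D + 1) e)).norm g
      (F := fun U V => ‖N.marginal ((V : TwoQubitOp) * (e (Fin.last D)).pairReduce g
        (circuit N D (fun l => e l.castSucc) U X) * (V : TwoQubitOp)ᴴ)‖)
      (fun U => (N.marginal.continuous_of_finiteDimensional.comp
        (continuous_conj_gate continuous_const continuous_id)).norm)
      (fun U => by rw [circuit, Layer.siteReduce_step])
    rw [heq, pow_succ', mul_assoc]
    refine (mul_le_mul_of_nonneg_left hq₁ (by positivity)).trans ?_
    rw [← integral_const_mul]
    refine integral_mono (integrable_gateLaw (continuous_const.mul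
      ((hred _).comp (continuous_circuit N X D _)).norm)) hint fun U => ?_
    refine le_trans ?_ (hcY _ (by rw [Layer.trace_pairReduce, trace_circuit N g, hX]))
    dsimp only
    rw [Layer.siteReduce_eq]
    calc _ ≤ c / 2 * (2 * ‖(e (Fin.last D)).pairReduce g
          (circuit N D (fun l => e l.castSucc) U X)‖) :=
          mul_le_mul (min_le_right _ _) (norm_qubitReduce_le _ _) (norm_nonneg _) (by positivity)
      _ = _ := by ring

theorem norm_trace_mul_siteOp_le (q : Fin n) {b : Matrix (Fin 2) (Fin 2) ℂ} (hb : bᴴ * b = 1)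
    (X : QubitsOp n) : ‖(X * siteOp q b).trace‖ ≤ traceNorm X := by
  rw [Matrix.trace_mul_comm]
  refine norm_trace_mul_le_traceNorm _ _ ?_
  rw [siteOp_conjTranspose, siteOp_mul, hb, siteOp_one]

/-- Each matrix unit on a qubit is the average of two unitaries, so each entry of the reduction is
controlled by trace duality. -/
theorem norm_siteReduce_le (q : Fin n) (X : QubitsOp n) : ‖siteReduce q X‖ ≤ traceNorm X := by
  have key : ∀ a b : Fin 2, ∃ u v : Matrix (Fin 2) (Fin 2) ℂ, uᴴ * u = 1 ∧ vᴴ * v = 1 ∧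
      Matrix.single b a 1 = (1 / 2 : ℂ) • (u + v) := by
    intro a b
    have hd : ∀ r s : ℂ, star r * r = 1 → star s * s = 1 →
        (!![r, 0; 0, s])ᴴ * !![r, 0; 0, s] = 1 := by
      intro r s hr hs
      ext i j
      fin_cases i <;> fin_cases j <;> simp [Matrix.mul_apply] <;> simpa
    have hx : ∀ r s : ℂ, star r * r = 1 → star s * s = 1 →
        (!![0, r; s, 0])ᴴ * !![0, r; s, 0] = 1 := by
      intro r s hr hs
      ext i j
      fin_cases i <;> fin_cases j <;> simp [Matrix.mul_apply] <;> simpa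
    by_cases hab : a = b
    · refine ⟨!![1, 0; 0, 1], !![if a = 0 then 1 else -1, 0; 0, if a = 0 then -1 else 1],
        hd _ _ (by simp) (by simp), hd _ _ (by split_ifs <;> simp) (by split_ifs <;> simp), ?_⟩
      ext i j
      subst hab
      fin_cases a <;> fin_cases i <;> fin_cases j <;> norm_num [Matrix.single_apply]
    · refine ⟨!![0, 1; 1, 0], !![0, if b = 0 then 1 else -1; if b = 0 then -1 else 1, 0],
        hx _ _ (by simp) (by simp), hx _ _ (by split_ifs <;> simp) (by split_ifs <;> simp), ?_⟩
      ext i j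
      fin_cases a <;> fin_cases b <;> fin_cases i <;> fin_cases j <;>
        first | exact absurd rfl hab | norm_num [Matrix.single_apply]
  rw [Matrix.norm_le_iff (traceNorm_nonneg X)]
  intro a b
  obtain ⟨u, v, hu, hv, huv⟩ := key a b
  rw [siteReduce_apply, huv, map_smul, map_add, Matrix.mul_smul, mul_add, Matrix.trace_smul,
    Matrix.trace_add, norm_smul]
  have := norm_add_le (X * siteOp q u).trace (X * siteOp q v).trace
  have h1 := norm_trace_mul_siteOp_le q hu X
  have h2 := norm_trace_mul_siteOp_le q hv X
  norm_num
  linarith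

theorem trace_basisState_mul {n : ℕ} (z : Fin n → Fin 2) (q : Fin n)
    (b : Matrix (Fin 2) (Fin 2) ℂ) :
    (basisState z * siteOp q b).trace = b (z q) (z q) := by
  rw [basisState, Matrix.trace_mul_comm, trace_mul_single]
  change piOp (Function.update 1 q b) z z = _
  rw [piOp_update_apply]
  simp

theorem one_le_norm_siteReduce {n : ℕ} {z z' : Fin n → Fin 2} {q : Fin n} (h : z q ≠ z' q) :
    1 ≤ ‖siteReduce q (basisState z - basisState z')‖ := by
  refine le_trans (le_of_eq ?_) (Matrix.norm_entry_le_entrywise_sup_norm _ (i := z q) (j := z q))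
  rw [siteReduce_apply, sub_mul, Matrix.trace_sub, trace_basisState_mul, trace_basisState_mul]
  simp [h]

/-- Test against Pauli `Z` on a qubit where the strings differ. -/
theorem two_le_traceNorm {n : ℕ} {z z' : Fin n → Fin 2} {q : Fin n} (h : z q ≠ z' q) :
    2 ≤ traceNorm (basisState z - basisState z') := by
  have hZ : (!![1, 0; 0, -1] : Matrix (Fin 2) (Fin 2) ℂ)ᴴ * !![1, 0; 0, -1] = 1 := by
    ext i j
    fin_cases i <;> fin_cases j <;> simp [Matrix.mul_apply]
  refine le_trans (le_of_eq ?_) (norm_trace_mul_siteOp_le q hZ _)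
  rw [sub_mul, Matrix.trace_sub, trace_basisState_mul, trace_basisState_mul]
  generalize z q = a at *
  generalize z' q = b at *
  fin_cases a <;> fin_cases b <;> simp at h ⊢ <;> norm_num

theorem exp_le_integral_traceNorm (N : NoiseChannel) (hN : N.HasNonconstantMarginal) :
    ∃ Γ : ℝ, 0 < Γ ∧
      ∀ (n m D : ℕ) (e : Fin D → Layer n m) (z z' : Fin n → Fin 2), z ≠ z' →
        Real.exp (-(Γ * D)) ≤
          (1 / 2) * ∫ U, traceNorm
            (circuit N D e U
              (basisState z - basisState z'))
            ∂(gateLaw D m) := by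
  obtain ⟨c, hc, hc1, hdecay⟩ := exists_decay_rate N hN
  -- This makes the target `(c/2)^D`; the extra `2` absorbs the prefactor `1/2` once `D ≥ 1`.
  refine ⟨Real.log (2 / c), Real.log_pos (by rw [lt_div_iff₀ hc]; linarith), ?_⟩
  intro n m D e z z' hz
  obtain ⟨q, hq⟩ := Function.ne_iff.mp hz
  have hexp : Real.exp (-(Real.log (2 / c) * D)) = (c / 2) ^ D := by
    rw [← neg_mul, ← Real.log_inv, inv_div, mul_comm, Real.exp_nat_mul,
      Real.exp_log (by positivity)]
  rw [hexp]
  cases D with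
  -- With no layer nothing absorbs the `1/2`, so the initial trace norm must be bounded by `2` from
  -- below.
  | zero =>
    simp only [circuit, integral_const, probReal_univ, smul_eq_mul, one_mul, pow_zero]
    linarith [two_le_traceNorm hq]
  | succ D =>
    have htr : (basisState z - basisState z').trace = 0 := by simp [basisState]
    obtain ⟨q', hq'⟩ := hdecay n m (D + 1) e _ htr q
    have hcont := continuous_circuit N (basisState z - basisState z') (D + 1) e
    have h1 : ∫ U, ‖siteReduce q' (circuit N (D + 1) e U (basisState z - basisState z'))‖
        ∂gateLaw (D + 1) m ≤
        ∫ U, traceNorm (circuit N (D + 1) e U (basisState z - basisState z'))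
          ∂gateLaw (D + 1) m := by
      exact integral_mono
        (integrable_gateLaw ((siteReduce q').continuous_of_finiteDimensional.comp hcont).norm)
        (integrable_gateLaw (continuous_traceNorm.comp hcont))
        fun U => norm_siteReduce_le _ _
    have h2 : (c / 2) ^ (D + 1) ≤ 1 / 2 * c ^ (D + 1) := by
      rw [div_pow, div_eq_inv_mul]
      refine mul_le_mul_of_nonneg_right ?_ (by positivity)
      rw [one_div, inv_le_inv₀ (by positivity) (by positivity)]
      exact le_self_pow₀ (by norm_num) (by simp)
    have h3 := mul_le_mul_of_nonneg_left (one_le_norm_siteReduce hq)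
      (pow_nonneg hc.le (D + 1))
    linarith

end NormedMatrices

end NoisyCircuit

theorem mainTheorem6 (N : NoisyCircuit.NoiseChannel) (hsymm : N.IsSymmetric)
    (hN : N.HasNonconstantMarginal) :
    ∃ Γ : ℝ, 0 < Γ ∧
      ∀ (n m D : ℕ) (e : Fin D → NoisyCircuit.Layer n m) (z z' : Fin n → Fin 2), z ≠ z' →
        Real.exp (-(Γ * D)) ≤
          (1 / 2) * ∫ U, NoisyCircuit.traceNorm
            (NoisyCircuit.circuit N D e U
              (NoisyCircuit.basisState z - NoisyCircuit.basisState z'))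
            ∂(NoisyCircuit.gateLaw D m) := by
  exact NoisyCircuit.exp_le_integral_traceNorm N hN
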